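/- Let $q$ be a prime power, let $u \ge 2$ be an integer, and let $K = \mathbb{F}_{q^u}$ be a finite field with $q^u$ elements. Let $\chi$ be the Norm–Trace curve over $K$, that is, the (irreducible) curve with affine equation $$x^{(q^u-1)/(q-1)} = y^{q^{u-1}} + y^{q^{u-2}} + \cdots + y^{q} + y,$$ whose function field $K(\chi)$ is the field of fractions of $K[x,y]/\bigl(y^{q^{u-1}} + \cdots + y^{q} + y - x^{(q^u-1)/(q-1)}\bigr)$. The $K$-gonality of a curve $X$ over $K$ is the smallest degree $[K(X) : \varphi^* K(\mathbb{P}^1_K)]$ of a dominant rational map $\varphi : X \dashrightarrow \mathbb{P}^1_K$ defined over $K$. Then the $K$-gonality of $\chi$ is exactly $q^{u-1}$. -/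

import Mathlib

open Polynomial
open scoped LinearAlgebra.Projectivization

noncomputable section

/-! ### Rational maps to the projective line and gonality

Here `F` is the field of rational functions `K(X)` of an integral curve `X` over `K`. -/

/-- A rational map over `K` from an integral variety with function field `F` to the projective
line over `K`: a pair of rational functions, not both zero, up to multiplication by a nonzero
rational function. -/
abbrev RatMapToP1 (F : Type*) [Field F] : Type _ := ℙ F (Fin 2 → F)

namespace RatMapToP1

variable (K : Type*) {F : Type*} [Field K] [Field F] [Algebra K F]

/-- A rational map `φ = [f₀ : f₁]` to the projective line over `K` is dominant if its image is
contained in no proper closed subset, that is, if no nonzero form `G` over `K` satisfies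
`G(f₀, f₁) = 0`. As `G` is a form, the choice of the representative `(f₀, f₁)` is immaterial. -/
def IsDominant (φ : RatMapToP1 F) : Prop :=
  ∀ (n : ℕ) (G : MvPolynomial (Fin 2) K),
    G.IsHomogeneous n → MvPolynomial.aeval φ.rep G = 0 → G = 0

/-- The pullback along a dominant rational map `φ = [f₀ : f₁]` of the function field of the
projective line, as a subfield of `F`. Rational functions on the projective line are the quotients
`G / H` of forms of the same degree with `H ≠ 0`; the pullback of `G / H` is
`G(f₀, f₁) / H(f₀, f₁)`. -/
def pullbackField (φ : RatMapToP1 F) : IntermediateField K F :=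
  IntermediateField.adjoin K
    {z : F | ∃ (n : ℕ) (G H : MvPolynomial (Fin 2) K),
      G.IsHomogeneous n ∧ H.IsHomogeneous n ∧ H ≠ 0 ∧
        z = MvPolynomial.aeval φ.rep G / MvPolynomial.aeval φ.rep H}

/-- The degree of a dominant rational map: the degree of the field extension of the function field
of the source over the (pulled back) function field of the target. It is a cardinal, so that an
infinite degree is not confused with a finite one. -/
def degree (φ : RatMapToP1 F) : Cardinal := Module.rank (pullbackField K φ) F

end RatMapToP1

/-- The `K`-gonality of a curve over `K` with function field `F`: the smallest degree of a dominant
rational map over `K` from the curve to the projective line over `K`. -/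
def gonality (K F : Type*) [Field K] [Field F] [Algebra K F] : ℕ :=
  sInf {d : ℕ | ∃ φ : RatMapToP1 F, φ.IsDominant K ∧ φ.degree K = (d : Cardinal)}

/-! ### The Norm–Trace curve -/

namespace NormTrace

variable (K : Type*) [Field K] (q u : ℕ)

/-- The polynomial `y ^ (q ^ (u - 1)) + ⋯ + y ^ q + y - x ^ ((q ^ u - 1) / (q - 1))` in `K[x][y]`:
the inner variable `C X` is `x`, the outer variable `X` is `y`. -/
def poly : K[X][X] :=
  (∑ i ∈ Finset.range u, (X : K[X][X]) ^ q ^ i) - C (X ^ ((q ^ u - 1) / (q - 1)))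

/-- The coordinate ring of the affine plane curve given by the Norm–Trace equation. -/
abbrev CoordinateRing : Type _ := K[X][X] ⧸ Ideal.span {poly K q u}

/-- The function field `K(χ)` of the Norm–Trace curve. -/
abbrev FunctionField : Type _ := FractionRing (CoordinateRing K q u)

variable {q u}

/-- Eisenstein's criterion at `y`, for the polynomial regarded as one in `x` over `K[y]`. -/
theorem poly_irreducible (hq : 2 ≤ q) (hu : 1 ≤ u) : Irreducible (poly K q u) := by
  obtain ⟨v, rfl⟩ : ∃ v, u = v + 1 := ⟨u - 1, by omega⟩
  set N := (q ^ (v + 1) - 1) / (q - 1) with hN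
  have hN0 : N ≠ 0 := by
    have h1 : q ≤ q ^ (v + 1) := by
      simpa using Nat.pow_le_pow_right (by omega : 0 < q) (by omega : 1 ≤ v + 1)
    exact (Nat.div_pos (by omega) (by omega)).ne'
  set T : K[X] := ∑ i ∈ Finset.range (v + 1), X ^ q ^ i with hT
  have hswap : Bivariate.swap (poly K q (v + 1)) = -(X ^ N - C T) := by
    simp only [poly, hT, hN, map_sub, map_sum, map_pow, Bivariate.swap_X, Bivariate.swap_Y, neg_sub]
  rw [← MulEquiv.irreducible_iff (Bivariate.swap (R := K)).toMulEquiv]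
  change Irreducible (Bivariate.swap (poly K q (v + 1)))
  rw [hswap]
  refine (Associated.refl (X ^ N - C T : K[X][X])).neg_left.irreducible_iff.2 ?_
  have hmonic : (X ^ N - C T : K[X][X]).Monic := monic_X_pow_sub_C T hN0
  have hdeg : (X ^ N - C T : K[X][X]).degree = N := degree_X_pow_sub_C (Nat.pos_of_ne_zero hN0) T
  have hT0 : T.coeff 0 = 0 := by
    simp only [hT, finsetSum_coeff, coeff_X_pow]
    refine Finset.sum_eq_zero fun i _ => if_neg ?_
    have : 0 < q ^ i := Nat.pow_pos (by omega)
    omega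
  have hT1 : T.coeff 1 = 1 := by
    simp only [hT, finsetSum_coeff, coeff_X_pow]
    rw [Finset.sum_eq_single 0]
    · simp
    · intro i _ hi
      have : 1 < q ^ i := Nat.one_lt_pow hi (by omega)
      exact if_neg (by omega)
    · simp
  refine irreducible_of_eisenstein_criterion (P := Ideal.span {(X : K[X])})
    ((Ideal.span_singleton_prime X_ne_zero).2 prime_X) ?_ ?_ ?_ ?_ hmonic.isPrimitive
  · rw [hmonic.leadingCoeff, Ideal.mem_span_singleton, X_dvd_iff]
    simp
  · intro n hn
    rw [hdeg, Nat.cast_lt] at hn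
    rw [Ideal.mem_span_singleton, X_dvd_iff, coeff_sub, coeff_X_pow, if_neg (by omega), coeff_C]
    split_ifs <;> simp [hT0]
  · rw [hdeg]
    exact_mod_cast Nat.pos_of_ne_zero hN0
  · rw [Ideal.span_singleton_pow, Ideal.mem_span_singleton, coeff_sub, coeff_X_pow,
      if_neg (by omega), coeff_C_zero, zero_sub, dvd_neg, X_pow_dvd_iff]
    intro h
    have := h 1 (by omega)
    rw [hT1] at this
    exact one_ne_zero this

/-- The Norm–Trace curve is irreducible. -/
theorem isDomain_coordinateRing (hq : 2 ≤ q) (hu : 1 ≤ u) : IsDomain (CoordinateRing K q u) := by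
  have h := (poly_irreducible K hq hu).prime
  exact (Ideal.Quotient.isDomain_iff_prime _).2 ((Ideal.span_singleton_prime h.ne_zero).2 h)

end NormTrace

end

/-! Upper bound: the equation is monic of degree `q ^ (u - 1)` in `y`, so the coordinate ring is
free of that rank over `K[x]`, and `[1 : x]` has degree `q ^ (u - 1)` (`exists_degree_eq`). Lower
bound: a map of degree `d` sends each affine rational point to one of the `q ^ u + 1` points of the
projective line over `K`, and each fibre contains at most `d` of them (`card_le_degree_mul`). The
fibre bound needs no divisor theory: functions equal to `1` at one point of the fibre and `0` at the
others are linearly independent over `K(t)` (`linearIndependent_of_interpolation`). The curve has `q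
^ (2 * u - 1)` affine rational points (`card_points`), because norms lie in the field of `q`
elements and every trace fibre there has `q ^ (u - 1)` elements. All these points are smooth, and
the count forces `d ≥ q ^ (u - 1)` without using points at infinity. -/

noncomputable section

/-! ### The pullback field and Möbius transformations -/

namespace RatMapToP1

variable {K F : Type*} [Field K] [Field F] [Algebra K F]

theorem aeval_smul_of_isHomogeneous {n : ℕ} {G : MvPolynomial (Fin 2) K} (hG : G.IsHomogeneous n)
    (a : F) (v : Fin 2 → F) :
    MvPolynomial.aeval (a • v) G = a ^ n * MvPolynomial.aeval v G := by
  rw [MvPolynomial.aeval_def, MvPolynomial.aeval_def, MvPolynomial.eval₂_eq',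
    MvPolynomial.eval₂_eq', Finset.mul_sum]
  refine Finset.sum_congr rfl fun d hd => ?_
  have h := hG (MvPolynomial.mem_support_iff.1 hd)
  rw [Finsupp.weight_apply, Finsupp.sum_fintype _ _ (by simp)] at h
  simp only [Fin.sum_univ_two, Pi.one_apply, smul_eq_mul, mul_one] at h
  simp only [Pi.smul_apply, smul_eq_mul, mul_pow, Finset.prod_mul_distrib,
    Finset.prod_pow_eq_pow_sum]
  rw [Fin.sum_univ_two, h]
  ring

theorem aeval_mem_adjoin {v : Fin 2 → F} {L : IntermediateField K F} (hv : ∀ i, v i ∈ L)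
    (G : MvPolynomial (Fin 2) K) : MvPolynomial.aeval v G ∈ L := by
  rw [MvPolynomial.aeval_def, MvPolynomial.eval₂_eq]
  exact sum_mem fun d _ => mul_mem (L.algebraMap_mem _) (prod_mem fun i _ => pow_mem (hv i) _)

theorem pullbackField_le {φ : RatMapToP1 F} {a : F} (ha : a ≠ 0) {L : IntermediateField K F}
    (h : ∀ i, φ.rep i / a ∈ L) : pullbackField K φ ≤ L := by
  refine IntermediateField.adjoin_le_iff.2 ?_
  rintro z ⟨n, G, H, hG, hH, -, rfl⟩
  have hrep : φ.rep = a • fun i => φ.rep i / a := by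
    ext i
    simp [mul_div_cancel₀ _ ha]
  rw [hrep, aeval_smul_of_isHomogeneous hG, aeval_smul_of_isHomogeneous hH,
    mul_div_mul_left _ _ (pow_ne_zero _ ha)]
  exact div_mem (aeval_mem_adjoin h G) (aeval_mem_adjoin h H)

theorem div_mem_pullbackField (φ : RatMapToP1 F) :
    φ.rep 1 / φ.rep 0 ∈ pullbackField K φ :=
  IntermediateField.subset_adjoin _ _ ⟨1, MvPolynomial.X 1, MvPolynomial.X 0,
    MvPolynomial.isHomogeneous_X _ _, MvPolynomial.isHomogeneous_X _ _,
    MvPolynomial.X_ne_zero _, by simp⟩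

theorem IsDominant.rep_ne_zero {φ : RatMapToP1 F} (hφ : φ.IsDominant K) (i : Fin 2) :
    φ.rep i ≠ 0 := fun h =>
  MvPolynomial.X_ne_zero i (hφ 1 (MvPolynomial.X i) (MvPolynomial.isHomogeneous_X _ _) (by simpa))

theorem IsDominant.sub_ne_zero {φ : RatMapToP1 F} (hφ : φ.IsDominant K) (c : K) :
    φ.rep 1 / φ.rep 0 - algebraMap K F c ≠ 0 := by
  intro h
  have h0 := hφ.rep_ne_zero 0
  have key := hφ 1 (MvPolynomial.X 1 - MvPolynomial.C c * MvPolynomial.X 0)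
    ((MvPolynomial.isHomogeneous_X _ _).sub
      (by simpa using (MvPolynomial.isHomogeneous_C _ c).mul (MvPolynomial.isHomogeneous_X K 0)))
    (by
      rw [sub_eq_zero, div_eq_iff h0] at h
      simp [h])
  have := congrArg (MvPolynomial.eval ![0, 1]) key
  simp at this

theorem pullbackField_eq {φ : RatMapToP1 F} (h0 : φ.rep 0 ≠ 0) :
    pullbackField K φ = IntermediateField.adjoin K {φ.rep 1 / φ.rep 0} := by
  refine le_antisymm (pullbackField_le h0 fun i => ?_)
    (IntermediateField.adjoin_simple_le_iff.2 (div_mem_pullbackField φ))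
  fin_cases i
  · simp [div_self h0]
  · exact IntermediateField.mem_adjoin_simple_self K _

/-- The parameter `t - c`, respectively `1 / t`, vanishing where `t` takes the value `c`,
respectively `∞`. -/
def shift (t : F) : Option K → F
  | none => t⁻¹
  | some c => t - algebraMap K F c

theorem IsDominant.shift_ne_zero {φ : RatMapToP1 F} (hφ : φ.IsDominant K) (c : Option K) :
    shift (φ.rep 1 / φ.rep 0) c ≠ 0 := by
  cases c with
  | none => exact inv_ne_zero (div_ne_zero (hφ.rep_ne_zero 1) (hφ.rep_ne_zero 0))
  | some c => exact hφ.sub_ne_zero c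

/-- Möbius changes of parameter preserve `K(t)`, so every fibre can be treated as the zero fibre of
a generator. -/
theorem adjoin_shift (t : F) (c : Option K) :
    IntermediateField.adjoin K {shift t c} = IntermediateField.adjoin K {t} := by
  have ht := IntermediateField.mem_adjoin_simple_self K t
  have hs := IntermediateField.mem_adjoin_simple_self K (shift t c)
  refine le_antisymm (IntermediateField.adjoin_simple_le_iff.2 ?_)
    (IntermediateField.adjoin_simple_le_iff.2 ?_) <;> cases c with
  | none => first | exact inv_mem ht | simpa [shift] using hs
  | some c => first
      | exact sub_mem ht (IntermediateField.algebraMap_mem _ c)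
      | simpa [shift] using add_mem hs (IntermediateField.algebraMap_mem _ c)

/-- Functions interpolating at finitely many places where `t` vanishes are linearly independent
over `K(t)`. -/
theorem linearIndependent_of_interpolation {ι : Type*} [DecidableEq ι] {B : ι → Type*}
    [∀ i, CommRing (B i)] [∀ i, Algebra K (B i)] (j : ∀ i, B i →ₐ[K] F)
    (hj : ∀ i, Function.Injective (j i)) (e : ∀ i, B i →ₐ[K] K) {t : F} (ht : t ≠ 0)
    (τ : ∀ i, B i) (hτ : ∀ i, j i (τ i) = t) (hτ0 : ∀ i, e i (τ i) = 0)
    (f : ι → F) (g : ∀ i, ι → B i) (hg : ∀ i k, j i (g i k) = f k)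
    (hge : ∀ i k, e i (g i k) = if i = k then 1 else 0) :
    LinearIndependent (IntermediateField.adjoin K {t}) f := by
  open scoped IntermediateField.algebraAdjoinAdjoin in
  -- Clearing denominators leaves a relation with coefficients in `K[t]`.
  rw [← LinearIndependent.iff_fractionRing (R := Algebra.adjoin K {t}), linearIndependent_iff']
  intro s a hsum
  have hrep (i : ι) : ∃ p : K[X], aeval t p = (a i : F) :=
    (SetLike.ext_iff.1 (Algebra.adjoin_singleton_eq_range_aeval K t) _).1 (a i).2
  choose p hp using hrep
  -- Infinite descent: evaluation at the place `k` kills every term except the constant coefficient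
  -- of `p k`. Hence `X` divides all coefficients, and the relation can be divided by `t`.
  have hdesc : ∀ n : ℕ, ∀ p : ι → K[X], ∑ i ∈ s, aeval t (p i) * f i = 0 →
      ∀ i ∈ s, X ^ n ∣ p i := by
    intro n
    induction n with
    | zero => simp
    | succ n ih =>
      intro p hps
      have h0 (k : ι) (hk : k ∈ s) : X ∣ p k := by
        have h1 : j k (∑ i ∈ s, aeval (τ k) (p i) * g k i) = 0 := by
          simp only [map_sum, map_mul, hg, ← Polynomial.aeval_algHom_apply, hτ, hps]
        have h2 := congrArg (e k) ((map_eq_zero_iff _ (hj k)).1 h1)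
        simp only [map_sum, map_mul, hge, ← Polynomial.aeval_algHom_apply, hτ0, mul_ite, mul_one,
          mul_zero, map_zero, Finset.sum_ite_eq, if_pos hk] at h2
        rwa [X_dvd_iff, coeff_zero_eq_aeval_zero]
      choose! r hr using h0
      intro i hi
      rw [hr i hi, pow_succ']
      refine mul_dvd_mul_left _ (ih r ?_ i hi)
      have : t * ∑ i ∈ s, aeval t (r i) * f i = 0 := by
        rw [← hps, Finset.mul_sum]
        refine Finset.sum_congr rfl fun k hk => ?_
        rw [hr k hk, map_mul, aeval_X, mul_assoc]
      exact (mul_eq_zero.1 this).resolve_left ht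
  intro i hi
  have hpi : p i = 0 := by
    by_contra hne
    have h1 := hdesc ((p i).natDegree + 1) p (by simpa [hp, Algebra.smul_def] using hsum) i hi
    have h2 := natDegree_le_of_dvd h1 hne
    simp at h2
  refine Subtype.ext ?_
  rw [← hp i, hpi]
  simp

end RatMapToP1

/-! ### Local rings at rational points -/

/-- If the ideal `P` is locally generated by one element then its local ring is a valuation ring. -/
theorem valuationRing_localization_atPrime {R : Type*} [CommRing R] [IsDomain R]
    [IsNoetherianRing R] (P : Ideal R) [P.IsPrime] {x : R} (hx : x ∈ P)
    (h : ∀ z ∈ P, ∃ s ∉ P, s * z ∈ Ideal.span {x}) : ValuationRing (Localization.AtPrime P) := by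
  have : IsNoetherianRing (Localization.AtPrime P) :=
    IsLocalization.isNoetherianRing P.primeCompl _ inferInstance
  suffices hP : (IsLocalRing.maximalIdeal (Localization.AtPrime P)).IsPrincipal from
    ((tfae_of_isNoetherianRing_of_isLocalRing_of_isDomain (Localization.AtPrime P)).out 1 4).2 hP
  refine ⟨algebraMap R _ x, ?_⟩
  rw [← Localization.AtPrime.map_eq_maximalIdeal]
  refine le_antisymm (Ideal.map_le_iff_le_comap.2 fun z hz => ?_)
    ((Submodule.span_singleton_le_iff_mem _ _).2 (Ideal.mem_map_of_mem _ hx))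
  obtain ⟨s, hs, hsz⟩ := h z hz
  obtain ⟨r, hr⟩ := Ideal.mem_span_singleton'.1 hsz
  have hu : IsUnit (algebraMap R (Localization.AtPrime P) s) :=
    IsLocalization.map_units (M := P.primeCompl) _ ⟨s, hs⟩
  rw [Ideal.mem_comap]
  refine (Ideal.unit_mul_mem_iff_mem (Ideal.span {algebraMap R _ x}) hu).1 ?_
  rw [← map_mul, ← hr, map_mul]
  exact Ideal.mul_mem_left _ _ (Ideal.mem_span_singleton_self _)

section RationalPoint

variable {K R : Type*} (F : Type*) [Field K] [CommRing R] [Algebra K R] [Field F]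
  [Algebra R F] [IsFractionRing R F] [Algebra K F] [IsScalarTower K R F] (e : R →ₐ[K] K)

instance isPrime_ker_algHom : (RingHom.ker e).IsPrime := RingHom.ker_isPrime _

/-- The local ring at a rational point. -/
abbrev PointRing : Type _ := Localization.AtPrime (RingHom.ker e)

namespace PointRing

/-- The inclusion of the local ring at a rational point in the function field. -/
def toField : PointRing e →ₐ[K] F :=
  IsLocalization.liftAlgHom (M := (RingHom.ker e).primeCompl) (f := IsScalarTower.toAlgHom K R F)
    fun y => IsUnit.mk0 _ fun h => y.2 <| by
      have : (y : R) = 0 := (IsFractionRing.injective R F) (by simpa using h)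
      rw [this]
      exact zero_mem _

/-- The evaluation of the local ring at a rational point. -/
def eval : PointRing e →ₐ[K] K :=
  IsLocalization.liftAlgHom (M := (RingHom.ker e).primeCompl) (f := e)
    fun y => IsUnit.mk0 _ fun h => y.2 h

@[simp]
theorem toField_algebraMap (r : R) : toField F e (algebraMap R _ r) = algebraMap R F r := by
  simp [toField]

@[simp]
theorem eval_algebraMap (r : R) : eval e (algebraMap R _ r) = e r := by
  simp [eval]

theorem toField_injective : Function.Injective (toField F e) := by
  rw [injective_iff_map_eq_zero]
  intro z hz
  obtain ⟨⟨r, s⟩, rfl⟩ := IsLocalization.mk'_surjective (RingHom.ker e).primeCompl z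
  have h := congrArg (toField F e) (IsLocalization.mk'_spec (PointRing e) r s)
  rw [map_mul, hz, zero_mul, toField_algebraMap] at h
  have hr : r = 0 := IsFractionRing.injective R F (by rw [← h, map_zero])
  simp [hr]

variable {F} [IsDomain R]

/-- In a valuation ring, `t` or `1 / t` is regular at the point. The residue field is `K`, so `t`
takes a value in `K` or has a pole there; `none` encodes the pole. -/
theorem exists_shift (hV : ValuationRing (PointRing e)) (t : F) :
    ∃ (c : Option K) (τ : PointRing e),
      toField F e τ = RatMapToP1.shift t c ∧ eval e τ = 0 := by
  have regular (τ : PointRing e) (hτ : toField F e τ = t) : ∃ (c : Option K) (τ : PointRing e),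
      toField F e τ = RatMapToP1.shift t c ∧ eval e τ = 0 :=
    ⟨some (eval e τ), τ - algebraMap K _ (eval e τ), by simp [RatMapToP1.shift, hτ], by simp⟩
  obtain ⟨a, b, hb, rfl⟩ := IsFractionRing.div_surjective (A := R) t
  have hb0 : algebraMap R F b ≠ 0 := IsFractionRing.to_map_ne_zero_of_mem_nonZeroDivisors hb
  obtain ⟨c, hc | hc⟩ := ValuationRing.cond (algebraMap R (PointRing e) a) (algebraMap R _ b)
  · have hc' := congrArg (toField F e) hc
    rw [map_mul, toField_algebraMap, toField_algebraMap] at hc'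
    have ha0 : algebraMap R F a ≠ 0 := fun h => hb0 (by rw [← hc', h, zero_mul])
    have hct : toField F e c = (algebraMap R F a / algebraMap R F b)⁻¹ := by
      rw [inv_div, eq_div_iff ha0, mul_comm, hc']
    by_cases h0 : eval e c = 0
    · exact ⟨none, c, hct, h0⟩
    · have hmax : RingHom.ker (eval e) = IsLocalRing.maximalIdeal _ :=
        IsLocalRing.eq_maximalIdeal
          (RingHom.ker_isMaximal_of_surjective (eval e) fun k => ⟨algebraMap K _ k, by simp⟩)
      have hu : IsUnit c := by
        by_contra hn
        exact h0 (RingHom.mem_ker.1 (hmax ▸ (IsLocalRing.mem_maximalIdeal c).2 hn))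
      obtain ⟨d, hd⟩ := hu.exists_right_inv
      refine regular d ?_
      have := congrArg (toField F e) hd
      rw [map_mul, hct, map_one] at this
      rw [inv_mul_eq_one₀ (div_ne_zero ha0 hb0)] at this
      exact this.symm
  · refine regular c ?_
    have hc' := congrArg (toField F e) hc
    rw [map_mul, toField_algebraMap, toField_algebraMap] at hc'
    rw [eq_div_iff hb0, mul_comm, hc']

end PointRing

variable [IsDomain R]

open RatMapToP1 in
/-- A curve with `N` rational points with discrete local rings has no dominant rational map to
`ℙ¹` over a field with `Q` elements of degree less than `N / (Q + 1)`. -/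
theorem card_le_degree_mul [Finite K] {ι : Type*} [Finite ι] [DecidableEq ι] (e : ι → R →ₐ[K] K)
    (hV : ∀ i, ValuationRing (PointRing (e i))) (f : ι → R)
    (hf : ∀ i k, e i (f k) = if i = k then 1 else 0) {φ : RatMapToP1 F} (hφ : φ.IsDominant K)
    {d : ℕ} (hd : φ.degree K = d) : Nat.card ι ≤ d * (Nat.card K + 1) := by
  classical
  have := Fintype.ofFinite K
  have := Fintype.ofFinite ι
  choose c τ hτ hτ0 using fun i =>
    PointRing.exists_shift (e i) (hV i) (φ.rep 1 / φ.rep 0)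
  -- Here `c i` is the value of `t` at the point `i`. As `Option K` has `Q + 1` elements, it
  -- suffices to bound each fibre by `d`.
  have key := Finset.card_le_mul_card_image_of_maps_to (s := (Finset.univ : Finset ι))
    (t := (Finset.univ : Finset (Option K))) (f := c) (fun _ _ => Finset.mem_univ _) d ?_
  · simpa using key
  intro b _
  have hli := linearIndependent_of_interpolation (ι := {i // c i = b})
    (j := fun i => PointRing.toField F (e i)) (fun i => PointRing.toField_injective F (e i))
    (fun i => PointRing.eval (e i)) (hφ.shift_ne_zero b) (fun i => τ i)
    (fun i => by rw [hτ, i.2]) (fun i => hτ0 i) (fun i => algebraMap R F (f i))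
    (fun i k => algebraMap R _ (f k)) (fun i k => by simp)
    (fun i k => by simp [hf, Subtype.ext_iff])
  rw [adjoin_shift, ← pullbackField_eq (hφ.rep_ne_zero 0)] at hli
  have hle := hli.cardinal_lift_le_rank
  change _ ≤ Cardinal.lift (φ.degree K) at hle
  rw [hd, Cardinal.mk_fintype, Cardinal.lift_natCast, Cardinal.lift_natCast, Nat.cast_le,
    Fintype.card_subtype] at hle
  exact hle

end RationalPoint

/-! ### Smooth points of affine plane curves -/

section PlaneCurve

variable {K : Type*} [Field K] (f : K[X][X])

/-- Evaluation of the coordinate ring of a plane curve at a rational point. -/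
def evalPoint {a b : K} (h : f.evalEval a b = 0) : (K[X][X] ⧸ Ideal.span {f}) →ₐ[K] K :=
  Ideal.Quotient.liftₐ (Ideal.span {f})
    { evalEvalRingHom a b with
      commutes' := fun k => by
        simp [Polynomial.algebraMap_apply] } fun z hz => by
      obtain ⟨r, rfl⟩ := Ideal.mem_span_singleton.1 hz
      change (f * r).evalEval a b = 0
      rw [evalEval_mul, h, zero_mul]

@[simp]
theorem evalPoint_mk {a b : K} (h : f.evalEval a b = 0) (g : K[X][X]) :
    evalPoint f h (Ideal.Quotient.mk _ g) = g.evalEval a b := rfl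

/-- Division by `y - b`, then by `x - a`: the maximal ideal of the point is generated by these two
elements. -/
theorem exists_eq_mul_add_mul {a b : K} (g : K[X][X]) (h : g.evalEval a b = 0) :
    ∃ (r : K[X][X]) (s : K[X]), g = (X - C (C b)) * r + C ((X - C a) * s) := by
  obtain ⟨r, hr⟩ := X_sub_C_dvd_sub_C_eval (a := C b) (p := g)
  obtain ⟨s, hs⟩ := (dvd_iff_isRoot (p := g.eval (C b)) (a := a)).2 h
  exact ⟨r, s, by rw [← hs, ← hr]; ring⟩

/-- The local ring of a plane curve at a smooth rational point is a valuation ring. -/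
theorem valuationRing_of_smooth {R : Type*} [CommRing R] [IsDomain R] [Algebra K R]
    (m : K[X][X] →+* R) (hm : Function.Surjective m) (h0 : m f = 0) (e : R →ₐ[K] K) {a b : K}
    (he : ∀ g, e (m g) = g.evalEval a b) (h : f.evalEval a b = 0)
    (hd : f.derivative.evalEval a b ≠ 0) : ValuationRing (PointRing e) := by
  have : IsNoetherianRing R := isNoetherianRing_of_surjective _ _ m hm
  refine valuationRing_localization_atPrime _ (x := m (C (X - C a))) ?_ ?_
  · rw [RingHom.mem_ker]
    simp [he, evalEval]
  obtain ⟨s, w, hs⟩ := exists_eq_mul_add_mul f h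
  -- Differentiating `f = (y - b) s + (x - a) w` in `y` shows that `s` takes the value of `∂f/∂y` at
  -- the point. So `s` is a local unit, and on the curve `y - b` is locally a multiple of `x - a`.
  have hsP : e (m s) ≠ 0 := by
    have h1 := congrArg (fun g => (derivative g).evalEval a b) hs
    simp only [derivative_add, derivative_mul, derivative_C, evalEval_add, evalEval_mul] at h1
    simp at h1
    simpa [he, ← h1] using hd
  have hsm : m s * m (X - C (C b)) = - m (C w) * m (C (X - C a)) := by
    rw [hs] at h0
    simp only [map_mul, map_add] at h0 ⊢
    linear_combination h0
  intro z hz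
  obtain ⟨g, rfl⟩ := hm z
  obtain ⟨r, v, hg⟩ := exists_eq_mul_add_mul (a := a) (b := b) g (by rw [← he]; exact hz)
  refine ⟨m s, hsP, Ideal.mem_span_singleton'.2 ⟨- m (C w) * m r + m s * m (C v), ?_⟩⟩
  rw [hg]
  simp only [map_mul, map_add] at hsm ⊢
  linear_combination (-m r) * hsm

/-- The function which is `1` at `(a, b)` and `0` at the other rational points. -/
def indicator [Finite K] (P : K × K) : K[X][X] :=
  C (1 - (X - C P.1) ^ (Nat.card K - 1)) * (1 - (X - C (C P.2)) ^ (Nat.card K - 1))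

theorem evalEval_indicator [Finite K] [DecidableEq K] (P Q : K × K) :
    (indicator Q).evalEval P.1 P.2 = if P = Q then 1 else 0 := by
  have := Fintype.ofFinite K
  have hK : Nat.card K - 1 ≠ 0 := by have := Finite.one_lt_card (α := K); omega
  have h (x y : K) : 1 - (x - y) ^ (Nat.card K - 1) = if x = y then 1 else 0 := by
    split_ifs with hxy
    · rw [hxy, sub_self, zero_pow hK, sub_zero]
    · rw [Nat.card_eq_fintype_card, FiniteField.pow_card_sub_one_eq_one _ (sub_ne_zero.2 hxy),
        sub_self]
  have : (indicator Q).evalEval P.1 P.2 =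
      (1 - (P.1 - Q.1) ^ (Nat.card K - 1)) * (1 - (P.2 - Q.2) ^ (Nat.card K - 1)) := by
    simp [indicator, evalEval]
  rw [this, h, h]
  simp only [Prod.ext_iff, ite_and]
  split_ifs <;> simp

/-- The number of rational points of a smooth affine plane curve over a field with `Q` elements is
at most `d * (Q + 1)`, where `d` is the degree of a dominant rational map to `ℙ¹`. -/
theorem card_points_le_degree_mul [Finite K] {R F : Type*} [CommRing R] [IsDomain R] [Algebra K R]
    [Field F] [Algebra R F] [IsFractionRing R F] [Algebra K F] [IsScalarTower K R F]
    (m : K[X][X] →+* R) (hm : Function.Surjective m) (h0 : m f = 0)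
    (e : {P : K × K // f.evalEval P.1 P.2 = 0} → R →ₐ[K] K)
    (he : ∀ P g, e P (m g) = g.evalEval P.1.1 P.1.2)
    (hs : ∀ a b, f.derivative.evalEval a b ≠ 0) {φ : RatMapToP1 F} (hφ : φ.IsDominant K) {d : ℕ}
    (hd : φ.degree K = d) :
    Nat.card {P : K × K // f.evalEval P.1 P.2 = 0} ≤ d * (Nat.card K + 1) := by
  classical
  exact card_le_degree_mul F e
    (fun P => valuationRing_of_smooth f m hm h0 (e P) (he P) P.2 (hs _ _))
    (fun P => m (indicator P.1)) (fun P Q => by simp [he, evalEval_indicator, Subtype.ext_iff]) hφ hd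

end PlaneCurve
/-! ### Rational points of the Norm–Trace curve -/

namespace NormTrace

/-- This makes `z ↦ z ^ q` a power of Frobenius, so that the trace is additive and `q = 0` in `K`.
-/
theorem exists_expChar_pow {K : Type*} [Field K] [Finite K] {q u : ℕ} (hq : IsPrimePow q)
    (hu : u ≠ 0) (hK : Nat.card K = q ^ u) :
    ∃ p k : ℕ, CharP K p ∧ p.Prime ∧ k ≠ 0 ∧ q = p ^ k := by
  have := Fintype.ofFinite K
  obtain ⟨p, hp, n, hn, hc⟩ := FiniteField.card' K
  obtain ⟨r, k, hr, hk, rfl⟩ := hq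
  rw [Nat.card_eq_fintype_card, hc] at hK
  have hr' : r.Prime := hr.nat_prime
  have : r = p := by
    refine (Nat.prime_dvd_prime_iff_eq hr' hn).1 (hr'.dvd_of_dvd_pow (n := n) ?_)
    rw [hK]
    exact dvd_pow (dvd_pow_self _ hk.ne') hu
  exact ⟨p, k, hp, hn, hk.ne', by rw [this]⟩

/-- The trace `b + b ^ q + ⋯ + b ^ (q ^ (u - 1))`. -/
def trace {K : Type*} [Field K] (p k u : ℕ) [ExpChar K p] : K →+ K where
  toFun b := ∑ i ∈ Finset.range u, b ^ (p ^ k) ^ i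
  map_zero' := Finset.sum_eq_zero fun i _ =>
    zero_pow (pow_ne_zero _ (pow_ne_zero _ (expChar_pos K p).ne'))
  map_add' x y := by
    rw [← Finset.sum_add_distrib]
    exact Finset.sum_congr rfl fun i _ => by rw [← pow_mul, add_pow_expChar_pow]

/-- Raising to the power `q` permutes the summands cyclically, since `b ^ (q ^ u) = b`. -/
theorem trace_pow {K : Type*} [Field K] [Finite K] {p k u : ℕ} [ExpChar K p]
    (hK : Nat.card K = (p ^ k) ^ u) (b : K) : trace p k u b ^ (p ^ k) = trace p k u b := by
  have := Fintype.ofFinite K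
  have h1 : trace p k u b ^ (p ^ k) = ∑ i ∈ Finset.range u, b ^ (p ^ k) ^ (i + 1) := by
    change (∑ i ∈ Finset.range u, b ^ (p ^ k) ^ i) ^ (p ^ k) = _
    rw [sum_pow_char_pow]
    exact Finset.sum_congr rfl fun i _ => by rw [← pow_mul, ← pow_succ]
  have h2 := Finset.sum_range_succ (fun i => b ^ (p ^ k) ^ i) u
  rw [Finset.sum_range_succ'] at h2
  have h3 : b ^ (p ^ k) ^ u = b := by rw [← hK, Nat.card_eq_fintype_card, FiniteField.pow_card]
  rw [h3, pow_zero, pow_one] at h2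
  rw [h1]
  exact add_right_cancel h2

/-- The trace is onto the set of solutions of `s ^ q = s`, with fibres of size `q ^ (u - 1)`. -/
theorem card_trace_fiber {K : Type*} [Field K] [Finite K] {p k u : ℕ} [ExpChar K p]
    (hq : 2 ≤ p ^ k) (hu : u ≠ 0) (hK : Nat.card K = (p ^ k) ^ u) {s : K} (hs : s ^ (p ^ k) = s) :
    Nat.card {b // trace p k u b = s} = (p ^ k) ^ (u - 1) := by
  classical
  have := Fintype.ofFinite K
  obtain ⟨v, rfl⟩ : ∃ v, u = v + 1 := ⟨u - 1, by omega⟩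
  set q := p ^ k with hqdef
  set T := trace (K := K) p k (v + 1) with hT
  -- Kernel and range have orders with product `q ^ (v + 1)`. Root counting bounds them by `q ^ v`
  -- and `q`, so both bounds are equalities.
  have hcard := T.ker.card_mul_index
  rw [AddSubgroup.index_ker, hK] at hcard
  have hq0 : X ^ q - X ≠ (0 : K[X]) := FiniteField.X_pow_card_sub_X_ne_zero K hq
  have hsub : (T.range : Set K) ⊆ (X ^ q - X : K[X]).roots.toFinset := by
    rintro _ ⟨b, rfl⟩
    simpa [hq0, sub_eq_zero] using trace_pow hK b
  have hroots : (X ^ q - X : K[X]).roots.toFinset.card ≤ q :=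
    (Multiset.toFinset_card_le _).trans ((card_roots' _).trans
      (FiniteField.X_pow_card_sub_X_natDegree_eq K hq).le)
  have hrange : Nat.card T.range ≤ q := by
    refine le_trans ?_ hroots
    rw [← Set.ncard_coe_finset]
    exact Set.ncard_le_ncard hsub (Finset.finite_toSet _)
  have hpoly : Monic (∑ i ∈ Finset.range (v + 1), X ^ q ^ i : K[X]) ∧
      (∑ i ∈ Finset.range (v + 1), X ^ q ^ i : K[X]).natDegree ≤ q ^ v := by
    rw [Finset.sum_range_succ_comm]
    have hlt : (∑ i ∈ Finset.range v, X ^ q ^ i : K[X]).degree < (q ^ v : ℕ) := by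
      refine (degree_sum_le _ _).trans_lt
        ((Finset.sup_lt_iff (WithBot.bot_lt_coe _)).2 fun i hi => ?_)
      rw [degree_X_pow, Nat.cast_lt]
      exact Nat.pow_lt_pow_right hq (Finset.mem_range.1 hi)
    refine ⟨monic_X_pow_add hlt, natDegree_le_of_degree_le ((degree_add_le _ _).trans ?_)⟩
    rw [degree_X_pow]
    exact max_le le_rfl hlt.le
  have hker : Nat.card T.ker ≤ q ^ v := by
    have hsub' : (T.ker : Set K) ⊆
        (∑ i ∈ Finset.range (v + 1), X ^ q ^ i : K[X]).roots.toFinset := by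
      intro b hb
      rw [Finset.mem_coe, Multiset.mem_toFinset, mem_roots hpoly.1.ne_zero, IsRoot,
        eval_finsetSum]
      simpa using (show ∑ i ∈ Finset.range (v + 1), b ^ q ^ i = 0 from hb)
    refine le_trans ?_ ((Multiset.toFinset_card_le _).trans ((card_roots' _).trans hpoly.2))
    rw [← Set.ncard_coe_finset]
    exact Set.ncard_le_ncard hsub' (Finset.finite_toSet _)
  have hkerpos : 0 < Nat.card T.ker := Nat.card_pos
  have hkereq : Nat.card T.ker = q ^ v := by
    refine hker.antisymm ?_
    by_contra! hlt
    have : Nat.card T.ker * Nat.card T.range < q ^ (v + 1) := by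
      rw [pow_succ]
      exact (Nat.mul_le_mul_left _ hrange).trans_lt (Nat.mul_lt_mul_of_pos_right hlt (by omega))
    omega
  have hrangeq : Nat.card T.range = q := by
    rw [hkereq, pow_succ] at hcard
    exact Nat.eq_of_mul_eq_mul_left (by positivity) hcard
  have hset : (T.range : Set K) = (X ^ q - X : K[X]).roots.toFinset := by
    refine Set.eq_of_subset_of_ncard_le hsub ?_ (Finset.finite_toSet _)
    rw [Set.ncard_coe_finset]
    exact hroots.trans hrangeq.ge
  have hsr : s ∈ (T.range : Set K) := by
    rw [hset]
    simp [hq0, hs]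
  obtain ⟨b₀, hb₀⟩ := hsr
  rw [add_tsub_cancel_right, ← hkereq]
  refine Nat.card_congr ((Equiv.subRight b₀).subtypeEquiv fun b => ?_)
  simp [AddMonoidHom.mem_ker, sub_eq_zero, hb₀]

theorem evalEval_poly {K : Type*} [Field K] {q u : ℕ} (a b : K) :
    (poly K q u).evalEval a b =
      ∑ i ∈ Finset.range u, b ^ q ^ i - a ^ ((q ^ u - 1) / (q - 1)) := by
  simp [poly, evalEval, eval_finsetSum]

/-- In characteristic dividing `q`, only the linear term `y` contributes to the derivative in `y`.
-/
theorem evalEval_derivative_poly {K : Type*} [Field K] {q u : ℕ} (hq : (q : K) = 0) (hu : u ≠ 0)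
    (a b : K) : (poly K q u).derivative.evalEval a b = 1 := by
  obtain ⟨v, rfl⟩ : ∃ v, u = v + 1 := ⟨u - 1, by omega⟩
  have hq' : (q : K[X][X]) = 0 := by simpa using congrArg (fun z => C (C z)) hq
  rw [poly, derivative_sub, derivative_C, sub_zero]
  simp [Finset.sum_range_succ', hq', derivative_X_pow]

theorem card_points {K : Type*} [Field K] [Finite K] {q u : ℕ} (hq : IsPrimePow q)
    (hu : u ≠ 0) (hK : Nat.card K = q ^ u) :
    Nat.card {P : K × K // (poly K q u).evalEval P.1 P.2 = 0} = q ^ u * q ^ (u - 1) := by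
  have := Fintype.ofFinite K
  have hq2 := hq.two_le
  obtain ⟨p, k, hp, hpp, hk, rfl⟩ := exists_expChar_pow hq hu hK
  have : ExpChar K p := ExpChar.prime hpp
  have e : {P : K × K // (poly K (p ^ k) u).evalEval P.1 P.2 = 0} ≃
      (a : K) × {b : K // trace p k u b = a ^ (((p ^ k) ^ u - 1) / (p ^ k - 1))} :=
    { toFun P := ⟨P.1.1, P.1.2, by
        have := P.2
        rw [evalEval_poly, sub_eq_zero] at this
        exact this⟩
      invFun z := ⟨(z.1, z.2.1), by
        rw [evalEval_poly, sub_eq_zero]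
        exact z.2.2⟩
      left_inv _ := rfl
      right_inv _ := rfl }
  rw [Nat.card_congr e, Nat.card_sigma, Finset.sum_congr rfl fun a _ =>
    card_trace_fiber hq2 hu hK ?_]
  · simp [← Nat.card_eq_fintype_card, hK]
  · set N := ((p ^ k) ^ u - 1) / (p ^ k - 1) with hN
    have hNq : N * (p ^ k - 1) = (p ^ k) ^ u - 1 :=
      Nat.div_mul_cancel (Nat.sub_one_dvd_pow_sub_one _ _)
    rcases eq_or_ne a 0 with rfl | ha
    · rcases eq_or_ne N 0 with h | h
      · simp [h]
      · rw [zero_pow h, zero_pow (by omega)]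
    -- The norm `a ^ N` lies in the field of `q` elements, as `N * (q - 1) = q ^ u - 1`.
    · have h1 : (a ^ N) ^ (p ^ k - 1) = 1 := by
        rw [← pow_mul, hNq, ← hK, Nat.card_eq_fintype_card,
          FiniteField.pow_card_sub_one_eq_one _ ha]
      conv_lhs => rw [show p ^ k = p ^ k - 1 + 1 by omega]
      rw [pow_succ, h1, one_mul]

/-! ### The coordinate function `x` -/

section Coordinate

variable {K : Type*} [Field K] {q u : ℕ}

theorem poly_monic_natDegree (hq : 2 ≤ q) (hu : u ≠ 0) :
    (poly K q u).Monic ∧ (poly K q u).natDegree = q ^ (u - 1) := by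
  obtain ⟨v, rfl⟩ : ∃ v, u = v + 1 := ⟨u - 1, by omega⟩
  have hlt : (∑ i ∈ Finset.range v, X ^ q ^ i -
      C (X ^ ((q ^ (v + 1) - 1) / (q - 1))) : K[X][X]).degree < (q ^ v : ℕ) := by
    refine (degree_sub_le _ _).trans_lt (max_lt ?_ ?_)
    · refine (degree_sum_le _ _).trans_lt
        ((Finset.sup_lt_iff (WithBot.bot_lt_coe _)).2 fun i hi => ?_)
      rw [degree_X_pow, Nat.cast_lt]
      exact Nat.pow_lt_pow_right hq (Finset.mem_range.1 hi)
    · refine degree_C_le.trans_lt ?_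
      exact_mod_cast Nat.pow_pos (n := v) (by omega : 0 < q)
  have heq : poly K q (v + 1) = X ^ q ^ v + (∑ i ∈ Finset.range v, X ^ q ^ i -
      C (X ^ ((q ^ (v + 1) - 1) / (q - 1))) : K[X][X]) := by
    rw [poly, Finset.sum_range_succ_comm, add_sub_assoc]
  rw [heq]
  refine ⟨monic_X_pow_add hlt, natDegree_eq_of_degree_eq_some ?_⟩
  rw [degree_add_eq_left_of_degree_lt (by rwa [degree_X_pow]), degree_X_pow, add_tsub_cancel_right]

/-- The map `[1 : x]` to the projective line. -/
def coordinateMap {F : Type*} [Field F] (x : F) : RatMapToP1 F :=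
  Projectivization.mk F ![1, x] fun h => one_ne_zero (congrFun h 0)

theorem exists_rep_coordinateMap {F : Type*} [Field F] (x : F) :
    ∃ a : F, a ≠ 0 ∧ (coordinateMap x).rep = a • ![1, x] := by
  obtain ⟨a, ha⟩ := Projectivization.exists_smul_eq_mk_rep F ![1, x]
    fun h => one_ne_zero (congrFun h 0)
  exact ⟨a, a.ne_zero, ha.symm⟩

/-- Dehomogenization is injective on forms of a fixed degree: the exponent of the second variable
determines the monomial. -/
theorem eq_zero_of_aeval_one_X {n : ℕ} {G : MvPolynomial (Fin 2) K} (hG : G.IsHomogeneous n)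
    (h : MvPolynomial.aeval ![1, (X : K[X])] G = 0) : G = 0 := by
  have hdeg (d : Fin 2 →₀ ℕ) (hd : MvPolynomial.coeff d G ≠ 0) : d 0 + d 1 = n := by
    have h := hG hd
    rw [Finsupp.weight_apply, Finsupp.sum_fintype _ _ (by simp)] at h
    simpa using h
  ext d
  by_contra hd
  rw [MvPolynomial.coeff_zero] at hd
  have h1 := congrArg (Polynomial.coeff · (d 1)) h
  simp only [MvPolynomial.aeval_def, MvPolynomial.eval₂_eq', Fin.prod_univ_two, finsetSum_coeff,
    Polynomial.algebraMap_apply, Algebra.algebraMap_self_apply, Matrix.cons_val_zero,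
    Matrix.cons_val_one, one_pow, one_mul, coeff_C_mul, coeff_X_pow, coeff_zero] at h1
  rw [Finset.sum_eq_single d] at h1
  · simp [hd] at h1
  · intro b hb hne
    rw [if_neg, mul_zero]
    intro h2
    have hb' := hdeg b (MvPolynomial.mem_support_iff.1 hb)
    have hd' := hdeg d hd
    refine hne (Finsupp.ext fun i => ?_)
    fin_cases i <;> simp <;> omega
  · intro hn
    exact absurd (MvPolynomial.mem_support_iff.2 hd) hn

theorem isDominant_coordinateMap {F : Type*} [Field F] [Algebra K F] {x : F}
    (hx : Transcendental K x) : (coordinateMap x).IsDominant K := by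
  intro n G hG h
  obtain ⟨a, ha, hrep⟩ := exists_rep_coordinateMap x
  rw [hrep, RatMapToP1.aeval_smul_of_isHomogeneous hG] at h
  have h1 := (mul_eq_zero.1 h).resolve_left (pow_ne_zero _ ha)
  refine eq_zero_of_aeval_one_X hG ((transcendental_iff_injective.1 hx) ?_)
  rw [map_zero, ← h1, ← AlgHom.comp_apply]
  refine DFunLike.congr_fun (MvPolynomial.algHom_ext fun i => ?_) G
  fin_cases i <;> simp

theorem pullbackField_coordinateMap {F : Type*} [Field F] [Algebra K F] (x : F) :
    RatMapToP1.pullbackField K (coordinateMap x) = IntermediateField.adjoin K {x} := by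
  obtain ⟨a, ha, hrep⟩ := exists_rep_coordinateMap x
  rw [RatMapToP1.pullbackField_eq (by simpa [hrep] using ha)]
  simp [hrep, mul_div_cancel_left₀ _ ha]

/-- If `F` is the fraction field of a domain which is finite free of rank `d` over `K[x]` then
`[F : K(x)] = d`. -/
theorem rank_adjoin_algebraMap_X {F R : Type*} [Field F] [Algebra K F] [CommRing R] [IsDomain R]
    [Algebra K R] [Algebra R F] [IsFractionRing R F] [IsScalarTower K R F] [Algebra K[X] R]
    [IsScalarTower K K[X] R] [Module.Finite K[X] R] [Module.Free K[X] R] :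
    Transcendental K (algebraMap R F (algebraMap K[X] R X)) ∧
    Module.rank (IntermediateField.adjoin K {algebraMap R F (algebraMap K[X] R X)}) F =
      Module.finrank K[X] R := by
  set x := algebraMap R F (algebraMap K[X] R X) with hxdef
  let φ : K[X] →ₐ[K] F := (IsScalarTower.toAlgHom K R F).comp (IsScalarTower.toAlgHom K K[X] R)
  have hφ : φ = aeval x := algHom_ext (by simp [φ, x])
  have hx : Transcendental K x := by
    rw [transcendental_iff_injective, ← hφ]
    exact (IsFractionRing.injective R F).comp (FaithfulSMul.algebraMap_injective K[X] R)
  refine ⟨hx, ?_⟩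
  let E := IntermediateField.adjoin K {x}
  let _ : Algebra K[X] F := φ.toRingHom.toAlgebra
  let _ : Algebra K[X] E := (aeval (IntermediateField.AdjoinSimple.gen K x)).toRingHom.toAlgebra
  have h1 (p : K[X]) : ((algebraMap K[X] E p : E) : F) = aeval x p :=
    (IntermediateField.AdjoinSimple.coe_aeval_gen_apply (F := K) x p)
  have : IsScalarTower K[X] R F := IsScalarTower.of_algebraMap_eq fun _ => rfl
  have : IsScalarTower K[X] E F := IsScalarTower.of_algebraMap_eq fun p =>
    (DFunLike.congr_fun hφ p).trans (h1 p).symm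
  have : FaithfulSMul K[X] E := (faithfulSMul_iff_algebraMap_injective K[X] E).2 fun p r hpr =>
    transcendental_iff_injective.1 hx (by rw [← h1, hpr, h1])
  have : IsFractionRing K[X] E := IsFractionRing.of_field _ _ fun z => by
    obtain ⟨r, s, hrs⟩ := (IntermediateField.mem_adjoin_simple_iff K _).1 z.2
    exact ⟨r, s, Subtype.ext (by rw [hrs]; simp [h1])⟩
  -- `E` and `F` are the fraction fields of `K[X]` and `R`, and the rank is unchanged by this
  -- localization.
  have key := Algebra.IsAlgebraic.lift_rank_of_isFractionRing K[X] E R F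
  rw [← Module.finrank_eq_rank K[X] R, Cardinal.lift_natCast, Cardinal.lift_eq_nat_iff] at key
  exact key
-- The two bounds for the gonality
theorem exists_degree_eq {q u : ℕ} (hq : 2 ≤ q) (hu : u ≠ 0) [IsDomain (CoordinateRing K q u)] :
    ∃ φ : RatMapToP1 (FunctionField K q u), φ.IsDominant K ∧
      φ.degree K = (q ^ (u - 1) : ℕ) := by
  obtain ⟨hmonic, hdeg⟩ := poly_monic_natDegree (K := K) hq hu
  let _ : Algebra K[X] (CoordinateRing K q u) :=
    inferInstanceAs (Algebra K[X] (AdjoinRoot (poly K q u)))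
  have : IsScalarTower K K[X] (CoordinateRing K q u) :=
    inferInstanceAs (IsScalarTower K K[X] (AdjoinRoot (poly K q u)))
  have : Module.Finite K[X] (CoordinateRing K q u) := hmonic.finite_adjoinRoot
  have : Module.Free K[X] (CoordinateRing K q u) := hmonic.free_adjoinRoot
  have hrank : Module.finrank K[X] (CoordinateRing K q u) = q ^ (u - 1) :=
    (AdjoinRoot.powerBasis' hmonic).finrank.trans hdeg
  obtain ⟨hx, h⟩ := rank_adjoin_algebraMap_X (K := K) (F := FunctionField K q u)
    (R := CoordinateRing K q u)
  refine ⟨coordinateMap _, isDominant_coordinateMap hx, ?_⟩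
  rw [RatMapToP1.degree, pullbackField_coordinateMap, h, hrank]

theorem le_degree {q u : ℕ} (hq : IsPrimePow q) (hu : u ≠ 0) [Finite K] (hK : Nat.card K = q ^ u)
    [IsDomain (CoordinateRing K q u)] {φ : RatMapToP1 (FunctionField K q u)}
    (hφ : φ.IsDominant K) {d : ℕ} (hd : φ.degree K = d) : q ^ (u - 1) ≤ d := by
  have hq2 := hq.two_le
  have hqK : (q : K) = 0 := by
    obtain ⟨p, k, hp, -, hk, rfl⟩ := exists_expChar_pow hq hu hK
    simp [hk]
  have hcount := card_points_le_degree_mul (poly K q u) (R := CoordinateRing K q u)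
    (Ideal.Quotient.mk _) Ideal.Quotient.mk_surjective
    (Ideal.Quotient.eq_zero_iff_mem.2 (Ideal.mem_span_singleton_self _))
    (fun P => evalPoint _ P.2) (fun P g => evalPoint_mk _ P.2 g)
    (fun a b => by rw [evalEval_derivative_poly hqK hu]; exact one_ne_zero) hφ hd
  rw [card_points hq hu hK, hK] at hcount
  -- The contradiction is `(q ^ (u - 1) - 1) * (q ^ u + 1) < q ^ u * q ^ (u - 1)`, which holds
  -- because `q ^ (u - 1) < q ^ u + 1`.
  by_contra! hlt
  have h1 : d * (q ^ u + 1) ≤ (q ^ (u - 1) - 1) * (q ^ u + 1) :=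
    Nat.mul_le_mul_right _ (by omega)
  have h2 : q ^ (u - 1) ≤ q ^ u := Nat.pow_le_pow_right (by omega) (by omega)
  have h3 : (q ^ (u - 1) - 1) * (q ^ u + 1) + (q ^ u + 1) = q ^ (u - 1) * (q ^ u + 1) := by
    rw [← Nat.succ_mul, Nat.succ_eq_add_one, Nat.sub_add_cancel (by omega)]
  have h4 : q ^ (u - 1) * (q ^ u + 1) = q ^ u * q ^ (u - 1) + q ^ (u - 1) := by ring
  omega

end Coordinate

end NormTrace

end

theorem lemma4p3 (q u : ℕ) (hq : IsPrimePow q) (hu : 2 ≤ u)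
    (K : Type*) [Field K] [Finite K] (hK : Nat.card K = q ^ u) :
    haveI : IsDomain (NormTrace.CoordinateRing K q u) :=
      NormTrace.isDomain_coordinateRing K hq.two_le (one_le_two.trans hu)
    gonality K (NormTrace.FunctionField K q u) = q ^ (u - 1) := by
  have : IsDomain (NormTrace.CoordinateRing K q u) :=
    NormTrace.isDomain_coordinateRing K hq.two_le (one_le_two.trans hu)
  have hu0 : u ≠ 0 := by omega
  -- The map `[1 : x]` also shows that the set of degrees is nonempty, which excludes the default
  -- value `sInf ∅ = 0`.
  refine le_antisymm (Nat.sInf_le (NormTrace.exists_degree_eq hq.two_le hu0))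
    (le_csInf ⟨_, NormTrace.exists_degree_eq hq.two_le hu0⟩ ?_)
  rintro d ⟨φ, hφ, hd⟩
  exact NormTrace.le_degree hq hu0 hK hφ hd
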